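/- A path is a finite word of unit north steps $N$ and east steps $E$, starting at $(0,0)$; $|v|$ is its number of steps. For a path $v$, let $\mathrm{Tam}(v)$ be the set of paths with the same endpoints as $v$ and weakly above $v$. For an integer point $p$ weakly above $v$, $\mathrm{horiz}_v(p)$ is the maximum number of east steps that can be added to the right of $p$ without crossing $v$. If a point $p$ of $u\in\mathrm{Tam}(v)$ is preceded by an east step $E$ and followed by a north step, let $p'$ be the first point of $u$ after $p$ with $\mathrm{horiz}_v(p')=\mathrm{horiz}_v(p)$, and let $u'$ be obtained from $u$ by switching $E$ and the part of $u$ between $p$ and $p'$; set $u<_v u'$. $\mathrm{Tam}(v)$ is ordered by the reflexive transitive closure of $<_v$. The complete binary trees with $n$ interior vertices are ordered by the reflexive transitive closure of right rotation, which replaces a subtree $((A,B),C)$ by $(A,(B,C))$. The post-order traversal on edges sends such a tree to the path obtained by walking around it, starting at the root and visiting left subtrees before right subtrees, and writing $N$ (resp. $E$) each time a left (resp. right) edge is traversed for the second time. The interior canopy of a complete binary tree is the path obtained by walking in the same way around the binary tree formed by its interior vertices, writing $N$ each time a left edge is traversed for the second time and $E$ each time a right edge is traversed for the first time. For a path $v$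 with $n-1$ steps, let $I(v)$ be the set of complete binary trees with $n$ interior vertices whose interior canopy is $v$. **Theorem.** Let $n\ge 1$. The post-order traversal on edges is an order isomorphism from the complete binary trees with $n$ interior vertices onto the usual Tamari lattice $\mathrm{Tam}((NE)^n)$. Under this identification, $$\mathrm{Tam}((NE)^n)=\bigsqcup_{|v|=n-1} I(v),$$ a disjoint union over all paths $v$ with $n-1$ steps, in which every $I(v)$ is a (non-empty) interval of $\mathrm{Tam}((NE)^n)$ and, with the induced order, is isomorphic to $\mathrm{Tam}(v)$. -/

import Mathlib

namespace NuTamari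

/-- A relation along which a natural-number statistic strictly increases generates an
antisymmetric reflexive transitive closure. -/
theorem reflTransGen_antisymm {α : Type*} {r : α → α → Prop} (f : α → ℕ)
    (h : ∀ a b, r a b → f a < f b) {a b : α}
    (hab : Relation.ReflTransGen r a b) (hba : Relation.ReflTransGen r b a) : a = b := by
  have key : ∀ {x y : α}, Relation.ReflTransGen r x y → x = y ∨ f x < f y := by
    intro x y hxy
    induction hxy with
    | refl => exact Or.inl rfl
    | tail _ hbc ih =>
      rcases ih with rfl | ih
      · exact Or.inr (h _ _ hbc)
      · exact Or.inr (ih.trans (h _ _ hbc))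
  rcases key hab with h1 | h1
  · exact h1
  · rcases key hba with h2 | h2
    · exact h2.symm
    · omega

/-! ### Lattice paths and the posets `Tam v` -/

/-- A unit step: north or east. -/
inductive Step : Type
  | N : Step
  | E : Step
  deriving DecidableEq

/-- A (finite) path on the square grid, starting at `(0,0)`, as its sequence of unit steps. -/
abbrev LatticePath : Type := List Step

/-- The point `(x, y)` at which a path ends. -/
def endpoint (w : LatticePath) : ℕ × ℕ := (w.count Step.E, w.count Step.N)

/-- The abscissa of the rightmost point of `v` at height `y`, that is, the number of east steps
of `v` before its `(y+1)`-st north step (for `y` at most the height of `v`). -/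
def rowEnd : LatticePath → ℕ → ℕ
  | [], _ => 0
  | Step.E :: v, y => rowEnd v y + 1
  | Step.N :: _, 0 => 0
  | Step.N :: v, y + 1 => rowEnd v y

/-- The horizontal distance of the point `p` to the path `v`: for `p` weakly above `v`,
the maximum number of east steps that can be added to the right of `p` without crossing `v`.
It is integer valued, so that the subtraction is not truncated. -/
def horiz (v : LatticePath) (p : ℕ × ℕ) : ℤ := (rowEnd v p.2 : ℤ) - (p.1 : ℤ)

/-- For `u` with the same endpoints as `v`: the path `u` is weakly above `v`, that is, no point
of `u` is strictly to the right of `v`. (The points of `u` are the endpoints of its prefixes.) -/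
def WeaklyAbove (u v : LatticePath) : Prop :=
  ∀ w : LatticePath, w <+: u → 0 ≤ horiz v (endpoint w)

/-- The underlying set of `Tam v`: the paths weakly above `v` with the same endpoints. -/
def Tam (v : LatticePath) : Type :=
  {u : LatticePath // endpoint u = endpoint v ∧ WeaklyAbove u v}

/-- The covering relation `u <_v u'`. Here `u = a E d b`; the point `p`, the end of `a E`, is
followed by a north step (`d` starts with `N`); the point `p'`, the end of `a E d`, is the first
point of `u` after `p` at the same horizontal distance to `v` as `p`; and `u' = a d E b` is
obtained by switching `E` and `d`. -/
def Cover (v u u' : LatticePath) : Prop :=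
  ∃ a d b : LatticePath,
    u = a ++ [Step.E] ++ d ++ b ∧
    d.head? = some Step.N ∧
    horiz v (endpoint (a ++ [Step.E] ++ d)) = horiz v (endpoint (a ++ [Step.E])) ∧
    (∀ d' : LatticePath, d' <+: d → d' ≠ [] → d' ≠ d →
      horiz v (endpoint (a ++ [Step.E] ++ d')) ≠ horiz v (endpoint (a ++ [Step.E]))) ∧
    u' = a ++ d ++ [Step.E] ++ b

/-- Number of pairs (north step, later east step); used only for antisymmetry. -/
def area : LatticePath → ℕ
  | [] => 0
  | Step.E :: w => area w
  | Step.N :: w => w.count Step.E + area w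

theorem area_append (a b : LatticePath) :
    area (a ++ b) = area a + area b + a.count Step.N * b.count Step.E := by
  induction a with
  | nil => simp [area]
  | cons s a ih =>
    cases s
    · simp [area, ih]; ring
    · simp [area, ih]

theorem Cover.area_lt {v u u' : LatticePath} (h : Cover v u u') : area u < area u' := by
  obtain ⟨a, d, b, rfl, hd, -, -, rfl⟩ := h
  have hpos : 0 < d.count Step.N := by
    cases d with
    | nil => simp at hd
    | cons s d => simp at hd; subst hd; simp
  simp [area_append, area, List.count_append]
  nlinarith

/-- The poset `Tam v`: its order is the reflexive transitive closure of the covering relation. -/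
instance (v : LatticePath) : PartialOrder (Tam v) where
  le := Relation.ReflTransGen fun x y => Cover v x.1 y.1
  le_refl _ := Relation.ReflTransGen.refl
  le_trans _ _ _ := Relation.ReflTransGen.trans
  le_antisymm _ _ :=
    reflTransGen_antisymm (fun x : Tam v => area x.1) fun _ _ h => h.area_lt

/-- The path `(NE)^n`. -/
def staircase (n : ℕ) : LatticePath := (List.replicate n [Step.N, Step.E]).flatten

/-! ### Complete binary trees and the Tamari order

A term `T : BinaryTree Unit` represents a binary tree (`nil` is the empty tree) and, at the same
time, its completion, the complete binary tree whose interior vertices are the nodes of `T` and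
whose external vertices are the occurrences of `nil`. -/

/-- One right rotation. At the root `s = (t, C)`, with left child `t = (A, B)`, it makes `t` the
right child of `s`, with `A` the left subtree of `s` and `B`, `C` the subtrees of `t`; it may be
applied at any interior vertex. -/
inductive RightRotation : BinaryTree Unit → BinaryTree Unit → Prop
  | root (A B C : BinaryTree Unit) :
      RightRotation (.node () (.node () A B) C) (.node () A (.node () B C))
  | left {L L' : BinaryTree Unit} (R : BinaryTree Unit) (h : RightRotation L L') :
      RightRotation (.node () L R) (.node () L' R)
  | right (L : BinaryTree Unit) {R R' : BinaryTree Unit} (h : RightRotation R R') :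
      RightRotation (.node () L R) (.node () L R')

/-- Sum over the vertices of the size of the right subtree; used only for antisymmetry. -/
def rightWeight : BinaryTree Unit → ℕ
  | .nil => 0
  | .node _ L R => rightWeight L + rightWeight R + R.numNodes

theorem RightRotation.numNodes_eq {T T' : BinaryTree Unit} (h : RightRotation T T') :
    T.numNodes = T'.numNodes := by
  induction h with
  | root => simp; ring
  | left _ _ ih => simp [ih]
  | right _ _ ih => simp [ih]

theorem RightRotation.rightWeight_lt {T T' : BinaryTree Unit} (h : RightRotation T T') :
    rightWeight T < rightWeight T' := by
  induction h with
  | root => simp [rightWeight]; omega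
  | left _ _ ih => simp [rightWeight, ih]
  | right _ h ih => simp only [rightWeight, h.numNodes_eq]; omega

/-- The complete binary trees with `n` interior vertices. -/
def TamariTree (n : ℕ) : Type := {T : BinaryTree Unit // T.numNodes = n}

/-- The Tamari order on complete binary trees with `n` interior vertices: the reflexive
transitive closure of right rotation. -/
instance (n : ℕ) : PartialOrder (TamariTree n) where
  le := Relation.ReflTransGen fun S T => RightRotation S.1 T.1
  le_refl _ := Relation.ReflTransGen.refl
  le_trans _ _ _ := Relation.ReflTransGen.trans
  le_antisymm _ _ :=
    reflTransGen_antisymm (fun T : TamariTree n => rightWeight T.1) fun _ _ h => h.rightWeight_lt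

/-- The post-order traversal on the edges of the complete binary tree: walk around it from the
root, left subtrees first, and record a north step (resp. east step) each time a left (resp.
right) edge, internal or external, is traversed for the second time. -/
def postorderPath : BinaryTree Unit → LatticePath
  | .nil => []
  | .node _ L R => postorderPath L ++ [Step.N] ++ postorderPath R ++ [Step.E]

/-- The letters of the contour word: `a` and `aBar` (resp. `b` and `bBar`) stand for the first
and the second traversal of a left (resp. right) edge. -/
inductive Letter : Type
  | a : Letter
  | aBar : Letter
  | b : Letter
  | bBar : Letter

/-- The word obtained by walking around the binary tree `B` (not its completion) from the root,
left subtrees first. -/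
def contour : BinaryTree Unit → List Letter
  | .nil => []
  | .node _ L R =>
      (if L = .nil then [] else [Letter.a] ++ contour L ++ [Letter.aBar]) ++
      (if R = .nil then [] else [Letter.b] ++ contour R ++ [Letter.bBar])

/-- The contribution of a letter to the canopy: `aBar` gives a north step and `b` an east step. -/
def Letter.canopyStep : Letter → Option Step
  | .aBar => some Step.N
  | .b => some Step.E
  | .a => none
  | .bBar => none

/-- The canopy of the binary tree `B`, which is the interior canopy of its completion. -/
def canopy (B : BinaryTree Unit) : LatticePath := (contour B).filterMap Letter.canopyStep

/-- `I(v)`, among the complete binary trees with `n` interior vertices: those with interior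
canopy `v`. -/
def canopyClass (n : ℕ) (v : LatticePath) : Set (TamariTree n) := {T | canopy T.1 = v}

end NuTamari

open NuTamari

/-!
A point of `u` at horizontal distance zero to `v` is a common point of the two paths. Cutting a
pair of non-crossing paths `(u, v)` at the last such point before the end, and removing the east
step that ends the upper path and starts the lower one in the last piece, decomposes the pair in
the same way as a binary tree decomposes into its left and right subtrees. Hence the binary trees
with canopy `v` correspond to the paths in `Tam v`, a tree being sent to the post-order traversal
of its internal edges.

A right rotation `((A, B), C) ↦ (A, (B, C))` preserves the canopy if and only if `B` is not empty,
and these rotations are exactly the covering relations of `Tam v`. All others increase the number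
of east steps of the canopy, so every `I(v)` is order-convex. The path of a minimal element of
`I(v)` is `v`, and that of a maximal element has no east step followed by a north step; both are
therefore unique, so that `I(v)` is an interval.

Turning the external vertices of a tree with `n` interior vertices into nodes yields a tree with
canopy `(NE)^n`, and its post-order traversal becomes the traversal of internal edges. So the first
isomorphism of the theorem is the case `v = (NE)^n` of the second.
-/

namespace NuTamari

open BinaryTree Relation Step

/-! ### Closures of relations -/

theorem reflTransGen_apply_iff {α β : Type*} {r : α → α → Prop} {s : β → β → Prop}
    (e : α ≃ β) (h : ∀ a b, s (e a) (e b) ↔ r a b) (a b : α) :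
    ReflTransGen s (e a) (e b) ↔ ReflTransGen r a b := by
  refine ⟨fun hs => ?_, ReflTransGen.lift e (fun a b => (h a b).2) a b⟩
  have hsymm := ReflTransGen.lift (p := r) e.symm
    (fun x y hxy => (h _ _).1 (by simpa using hxy)) _ _ hs
  simpa [Function.onFun] using hsymm

theorem reflTransGen_subtype_iff {α : Type*} {r : α → α → Prop} {p : α → Prop}
    (hp : ∀ x y z, ReflTransGen r x y → ReflTransGen r y z → p x → p z → p y)
    (a b : Subtype p) :
    ReflTransGen (fun x y : Subtype p => r x y) a b ↔ ReflTransGen r a.1 b.1 := by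
  refine ⟨ReflTransGen.lift (p := r) Subtype.val (fun _ _ h => h) a b, ?_⟩
  obtain ⟨b, hb⟩ := b
  intro (h : ReflTransGen r a.1 b)
  induction h with
  | refl => exact .refl
  | tail hax hxy ih => exact (ih (hp _ _ _ hax (.single hxy) a.2 hb)).tail hxy

/-! ### Horizontal distances and concatenation -/

@[simp] theorem fst_endpoint (w : LatticePath) : (endpoint w).1 = w.count E := rfl

@[simp] theorem snd_endpoint (w : LatticePath) : (endpoint w).2 = w.count N := rfl

theorem endpoint_append (a b : LatticePath) : endpoint (a ++ b) = endpoint a + endpoint b := by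
  simp [endpoint]

theorem count_eq_of_endpoint_eq {u v : LatticePath} (h : endpoint u = endpoint v) (s : Step) :
    u.count s = v.count s := by
  cases s
  · exact congrArg Prod.snd h
  · exact congrArg Prod.fst h

theorem length_eq_of_endpoint_eq {u v : LatticePath} (h : endpoint u = endpoint v) :
    u.length = v.length :=
  (List.perm_iff_count.2 (count_eq_of_endpoint_eq h)).length_eq

theorem rowEnd_append_add (v w : LatticePath) (y : ℕ) :
    rowEnd (v ++ w) (v.count N + y) = v.count E + rowEnd w y := by
  induction v with
  | nil => simp
  | cons s v ih =>
    cases s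
    · rw [List.count_cons_self, add_right_comm, List.cons_append, rowEnd, ih]
      simp
    · simp [rowEnd, ih, add_right_comm]

theorem rowEnd_append_north (v w : LatticePath) {y : ℕ} (h : y ≤ v.count N) :
    rowEnd (v ++ N :: w) y = rowEnd v y := by
  fun_induction rowEnd v y <;> simp_all [rowEnd]

theorem rowEnd_le_rowEnd_append (v w : LatticePath) (y : ℕ) :
    rowEnd v y ≤ rowEnd (v ++ w) y := by
  fun_induction rowEnd v y <;> simp_all [rowEnd]

theorem rowEnd_le_count (v : LatticePath) (y : ℕ) : rowEnd v y ≤ v.count E := by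
  fun_induction rowEnd v y <;> simp_all

theorem exists_eq_append_north {v : LatticePath} {y : ℕ} (hy : y < v.count N) :
    ∃ v₁ v₂, v = v₁ ++ N :: v₂ ∧ endpoint v₁ = (rowEnd v y, y) := by
  fun_induction rowEnd v y with
  | case1 => simp at hy
  | case2 y v ih =>
    obtain ⟨v₁, v₂, rfl, h⟩ := ih (by simpa using hy)
    exact ⟨E :: v₁, v₂, rfl, by simp_all [endpoint]⟩
  | case3 v => exact ⟨[], v, rfl, rfl⟩
  | case4 v y ih =>
    obtain ⟨v₁, v₂, rfl, h⟩ := ih (by simpa using hy)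
    exact ⟨N :: v₁, v₂, rfl, by simp_all [endpoint]⟩

theorem horiz_append {a v : LatticePath} (h : endpoint a = endpoint v) (w b : LatticePath) :
    horiz (v ++ w) (endpoint (a ++ b)) = horiz w (endpoint b) := by
  rw [endpoint_append, h, horiz, Prod.snd_add, snd_endpoint, snd_endpoint, rowEnd_append_add,
    horiz, Prod.fst_add, fst_endpoint]
  simp

theorem horiz_append_north (v w : LatticePath) {p : ℕ × ℕ} (h : p.2 ≤ v.count N) :
    horiz (v ++ N :: w) p = horiz v p := by
  rw [horiz, rowEnd_append_north v w h, horiz]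

theorem horiz_cons_east (v : LatticePath) (p : ℕ × ℕ) : horiz (E :: v) p = horiz v p + 1 := by
  simp only [horiz, rowEnd]
  push_cast
  ring

theorem horiz_cons_north (v w : LatticePath) :
    horiz (N :: v) (endpoint (N :: w)) = horiz v (endpoint w) := by
  simp [horiz, rowEnd]

theorem horiz_append_east (v w : LatticePath) :
    horiz v (endpoint (w ++ [E])) = horiz v (endpoint w) - 1 := by
  simp only [horiz, endpoint, List.count_append, List.count_singleton]
  simp [sub_sub]

theorem horiz_endpoint_self (v : LatticePath) : horiz v (endpoint v) = 0 := by
  simpa [horiz, rowEnd] using horiz_append (rfl : endpoint v = endpoint v) [] []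

/-! ### Pairs of non-crossing paths -/

/-- A pair of non-crossing paths: `u` has the same endpoints as `v` and is weakly above `v`, so
that `Tam v` is the type of all `u` with `NonCrossing u v`. -/
def NonCrossing (u v : LatticePath) : Prop := endpoint u = endpoint v ∧ WeaklyAbove u v

/-- A pair of non-crossing paths `(u, v)` such that the last point of `u` is its only point at
horizontal distance zero to `v`. These pairs are the indecomposable pieces in the decomposition of
non-crossing pairs at the points at horizontal distance zero. -/
def MeetsOnlyAtEnd (u v : LatticePath) : Prop :=
  NonCrossing u v ∧ ∀ w, w <+: u → w ≠ u → 0 < horiz v (endpoint w)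

theorem prefix_append_cases {w a b : LatticePath} (h : w <+: a ++ b) :
    w <+: a ∨ ∃ c, w = a ++ c ∧ c <+: b := by
  obtain ⟨t, ht⟩ := h
  rcases List.append_eq_append_iff.1 ht with ⟨c, hc, -⟩ | ⟨c, hw, hb⟩
  · exact Or.inl ⟨c, hc.symm⟩
  · exact Or.inr ⟨c, hw, t, hb.symm⟩

theorem NonCrossing.refl (v : LatticePath) : NonCrossing v v := by
  refine ⟨rfl, ?_⟩
  rintro w ⟨t, rfl⟩
  have h := horiz_append (rfl : endpoint w = endpoint w) t []
  rw [List.append_nil] at h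
  rw [h]
  simp [horiz]

theorem NonCrossing.append {u v u' v' : LatticePath} (h : NonCrossing u v)
    (h' : NonCrossing u' v') : NonCrossing (u ++ u') (v ++ v') := by
  refine ⟨by rw [endpoint_append, endpoint_append, h.1, h'.1], fun w hw => ?_⟩
  rcases prefix_append_cases hw with hw | ⟨c, rfl, hc⟩
  · have hrow := rowEnd_le_rowEnd_append v v' (endpoint w).2
    have hw := h.2 w hw
    simp only [horiz] at hw ⊢
    omega
  · rw [horiz_append h.1]
    exact h'.2 c hc

theorem NonCrossing.of_append_north {p q v₁ v₂ : LatticePath}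
    (h : NonCrossing (p ++ N :: q) (v₁ ++ N :: v₂)) (he : endpoint p = endpoint v₁) :
    NonCrossing p v₁ ∧ NonCrossing q v₂ := by
  refine ⟨⟨he, fun w hw => ?_⟩, ?_, fun w hw => ?_⟩
  · rw [← horiz_append_north v₁ v₂]
    · exact h.2 w (List.prefix_append_of_prefix hw)
    · rw [← snd_endpoint v₁, ← he]
      exact hw.count_le N
  · have := h.1
    rw [endpoint_append, endpoint_append, he] at this
    simpa [endpoint] using add_left_cancel this
  · rw [← horiz_cons_north, ← horiz_append he]
    exact h.2 _ (by simpa [List.prefix_append_right_inj, List.cons_prefix_cons] using hw)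

theorem MeetsOnlyAtEnd.nil : MeetsOnlyAtEnd [] [] :=
  ⟨.refl [], fun _ hw hne => absurd (List.prefix_nil.1 hw) hne⟩

theorem NonCrossing.shift_east {u v : LatticePath} (h : NonCrossing u v) :
    MeetsOnlyAtEnd (u ++ [E]) (E :: v) := by
  have he : endpoint (u ++ [E]) = endpoint (E :: v) := by
    simpa [endpoint] using h.1
  have hpos : ∀ w, w <+: u → 0 < horiz (E :: v) (endpoint w) := fun w hw => by
    rw [horiz_cons_east]
    exact Int.lt_add_one_of_le (h.2 w hw)
  refine ⟨⟨he, fun w hw => ?_⟩, fun w hw hne => ?_⟩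
  · rcases List.prefix_concat_iff.1 hw with rfl | hw
    · rw [he, horiz_endpoint_self]
    · exact (hpos w hw).le
  · exact hpos w ((List.prefix_concat_iff.1 hw).resolve_left hne)

theorem MeetsOnlyAtEnd.eq_nil_or_shift_east {u v : LatticePath} (h : MeetsOnlyAtEnd u v) :
    (u = [] ∧ v = []) ∨ ∃ u' v', u = u' ++ [E] ∧ v = E :: v' ∧ NonCrossing u' v' := by
  obtain ⟨⟨he, -⟩, hpos⟩ := h
  rcases List.eq_nil_or_concat' u with rfl | ⟨u, s, rfl⟩
  · exact Or.inl ⟨rfl, List.length_eq_zero_iff.1 (length_eq_of_endpoint_eq he).symm⟩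
  replace hpos : ∀ w, w <+: u → 0 < horiz v (endpoint w) := fun w hw =>
    hpos w (List.prefix_append_of_prefix hw) fun h => by simpa [h] using hw.length_le
  obtain rfl : s = E := by
    cases s
    · have hu := hpos u List.prefix_rfl
      have hrow := rowEnd_le_count v (endpoint u).2
      have hcount : u.count E = v.count E := by simpa using count_eq_of_endpoint_eq he E
      simp only [horiz, fst_endpoint] at hu
      omega
    · rfl
  have hstart := hpos [] List.nil_prefix
  rcases v with _ | ⟨_ | _, v⟩
  · simp [horiz, rowEnd] at hstart
  · simp [horiz, rowEnd] at hstart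
  refine Or.inr ⟨u, v, rfl, rfl, by simpa [endpoint] using he, fun w hw => ?_⟩
  have hw := hpos w hw
  rw [horiz_cons_east] at hw
  omega

-- In the second case `p` is the longest proper prefix of `u` at horizontal distance zero.
theorem NonCrossing.meetsOnlyAtEnd_or_split {u v : LatticePath} (h : NonCrossing u v) :
    MeetsOnlyAtEnd u v ∨ ∃ p q v₁ v₂, u = p ++ N :: q ∧ v = v₁ ++ N :: v₂ ∧
      NonCrossing p v₁ ∧ MeetsOnlyAtEnd q v₂ := by
  let Z : Set LatticePath := {w | w <+: u ∧ w ≠ u ∧ horiz v (endpoint w) = 0}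
  rcases Z.eq_empty_or_nonempty with hZ | hZ
  · refine Or.inl ⟨h, fun w hw hne => (h.2 w hw).lt_of_ne' fun h0 => ?_⟩
    exact Set.eq_empty_iff_forall_notMem.1 hZ w ⟨hw, hne, h0⟩
  have hfin : Z.Finite := u.inits.finite_toSet.subset fun w hw => (List.mem_inits w u).2 hw.1
  obtain ⟨p, ⟨⟨t, rfl⟩, hpu, hp⟩, hmax⟩ := Z.exists_max_image List.length hfin hZ
  rcases t with _ | ⟨_ | _, q⟩
  · simp at hpu
  · have hlt : (endpoint p).2 < v.count N := by
      rw [snd_endpoint, ← count_eq_of_endpoint_eq h.1 N, List.count_append, List.count_cons_self]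
      omega
    obtain ⟨v₁, v₂, rfl, he⟩ := exists_eq_append_north hlt
    have hep : endpoint p = endpoint v₁ := by
      simp only [horiz] at hp
      exact he ▸ Prod.ext (by simp only; omega) rfl
    obtain ⟨hleft, hright⟩ := h.of_append_north hep
    refine Or.inr ⟨p, q, v₁, v₂, rfl, rfl, hleft, hright, fun w hw hne => ?_⟩
    refine (hright.2 w hw).lt_of_ne' fun h0 => ?_
    have hlen := hmax (p ++ N :: w) ⟨by simpa [List.prefix_append_right_inj] using hw,
      by simpa using hne, by rw [horiz_append hep, horiz_cons_north, h0]⟩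
    simp at hlen
  · have hE := h.2 (p ++ [E]) ⟨q, by simp⟩
    rw [horiz_append_east] at hE
    omega

/-! ### Paths of trees -/

/-- The part of the post-order traversal on the internal edges of a binary tree that is
contributed by an edge of type `s` (`N` for a left edge, `E` for a right edge) together with the
subtree `T` below it. An empty subtree means that there is no such edge. -/
def branchPath : Step → BinaryTree Unit → LatticePath
  | _, .nil => []
  | s, .node _ L R => branchPath N L ++ branchPath E R ++ [s]

/-- The post-order traversal on the edges of a binary tree, as opposed to those of its completion
(see `postorderPath`). -/
def interiorPath : BinaryTree Unit → LatticePath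
  | .nil => []
  | .node _ L R => branchPath N L ++ branchPath E R

/-- The part of the canopy of a binary tree that is contributed by an edge of type `s` together
with the subtree `T` below it. -/
def branchCanopy : Step → BinaryTree Unit → LatticePath
  | _, .nil => []
  | N, T@(.node _ _ _) => canopy T ++ [N]
  | E, T@(.node _ _ _) => E :: canopy T

theorem interiorPath_node (x : Unit) (L R : BinaryTree Unit) :
    interiorPath (.node x L R) = branchPath N L ++ branchPath E R := rfl

@[simp] theorem branchPath_nil (s : Step) : branchPath s .nil = [] := rfl

theorem branchPath_of_ne_nil (s : Step) {T : BinaryTree Unit} (hT : T ≠ .nil) :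
    branchPath s T = interiorPath T ++ [s] := by
  cases T
  · contradiction
  · rfl

@[simp] theorem branchCanopy_nil (s : Step) : branchCanopy s .nil = [] := by cases s <;> rfl

theorem branchCanopy_north_of_ne_nil {T : BinaryTree Unit} (hT : T ≠ .nil) :
    branchCanopy N T = canopy T ++ [N] := by
  cases T
  · contradiction
  · rfl

theorem branchCanopy_east_of_ne_nil {T : BinaryTree Unit} (hT : T ≠ .nil) :
    branchCanopy E T = E :: canopy T := by
  cases T
  · contradiction
  · rfl

theorem canopy_nil : canopy .nil = [] := rfl

theorem canopy_node (x : Unit) (L R : BinaryTree Unit) :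
    canopy (.node x L R) = branchCanopy N L ++ branchCanopy E R := by
  cases L <;> cases R <;>
    simp [canopy, branchCanopy, contour, Letter.canopyStep, List.filterMap_cons]

theorem dropLast_branchPath (s : Step) (T : BinaryTree Unit) :
    (branchPath s T).dropLast = interiorPath T := by
  cases T <;> simp [branchPath, interiorPath]

theorem dropLast_branchCanopy_north (T : BinaryTree Unit) :
    (branchCanopy N T).dropLast = canopy T := by
  cases T <;> simp [branchCanopy, canopy_nil]

theorem tail_branchCanopy_east (T : BinaryTree Unit) : (branchCanopy E T).tail = canopy T := by
  cases T <;> simp [branchCanopy, canopy_nil]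

theorem length_branchPath (s : Step) (T : BinaryTree Unit) :
    (branchPath s T).length = T.numNodes := by
  induction T generalizing s with
  | nil => rfl
  | node _ L R ihL ihR => simp [branchPath, ihL, ihR, add_assoc]

theorem nonCrossing_branch (s : Step) (T : BinaryTree Unit) :
    NonCrossing (branchPath s T) (branchCanopy s T) := by
  induction T generalizing s with
  | nil => cases s <;> exact .refl []
  | node _ L R ihL ihR =>
    have hT := (ihL N).append (ihR E)
    rw [← canopy_node] at hT
    cases s
    · exact hT.append (.refl [N])
    · exact hT.shift_east.1

theorem nonCrossing_interiorPath_canopy (T : BinaryTree Unit) :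
    NonCrossing (interiorPath T) (canopy T) := by
  cases T with
  | nil => exact .refl []
  | node _ L R =>
    rw [interiorPath, canopy_node]
    exact (nonCrossing_branch N L).append (nonCrossing_branch E R)

theorem endpoint_interiorPath (T : BinaryTree Unit) :
    endpoint (interiorPath T) = endpoint (canopy T) :=
  (nonCrossing_interiorPath_canopy T).1

theorem meetsOnlyAtEnd_branch (R : BinaryTree Unit) :
    MeetsOnlyAtEnd (branchPath E R) (branchCanopy E R) := by
  by_cases hR : R = .nil
  · exact hR ▸ .nil
  · rw [branchPath_of_ne_nil E hR, branchCanopy_east_of_ne_nil hR]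
    exact (nonCrossing_interiorPath_canopy R).shift_east

theorem length_interiorPath_add_one {T : BinaryTree Unit} (hT : T ≠ .nil) :
    (interiorPath T).length + 1 = T.numNodes := by
  simpa [branchPath_of_ne_nil N hT] using length_branchPath N T

theorem length_canopy_add_one {T : BinaryTree Unit} (hT : T ≠ .nil) :
    (canopy T).length + 1 = T.numNodes := by
  rw [← length_eq_of_endpoint_eq (endpoint_interiorPath T), length_interiorPath_add_one hT]

/-! ### Trees correspond to non-crossing pairs -/

theorem horiz_interiorPath_left {L : BinaryTree Unit} (hL : L ≠ .nil) (R : BinaryTree Unit) :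
    horiz (canopy (.node () L R)) (endpoint (interiorPath L)) = 0 := by
  rw [canopy_node, branchCanopy_north_of_ne_nil hL, List.append_assoc, List.singleton_append,
    endpoint_interiorPath, horiz_append_north _ _ le_rfl, horiz_endpoint_self]

-- The root of the left subtree is read off the last point at horizontal distance zero before the
-- end of the path: a longer left subtree would put such a point inside `branchPath E R`.
theorem numNodes_left_le {L R L' R' : BinaryTree Unit}
    (hU : interiorPath (.node () L R) = interiorPath (.node () L' R'))
    (hV : canopy (.node () L R) = canopy (.node () L' R')) : L'.numNodes ≤ L.numNodes := by
  by_contra! hlt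
  have hL' : L' ≠ .nil := by rintro rfl; simp at hlt
  have hlen := length_interiorPath_add_one hL'
  have hprefix : interiorPath L' ++ [N] <+: branchPath N L ++ branchPath E R := by
    rw [interiorPath, interiorPath, branchPath_of_ne_nil N hL'] at hU
    exact hU ▸ List.prefix_append _ _
  obtain ⟨c, hc⟩ := List.prefix_of_prefix_length_le (List.prefix_append (branchPath N L) _)
    ((List.prefix_append _ _).trans hprefix) (by rw [length_branchPath]; omega)
  rw [← hc, List.append_assoc, List.prefix_append_right_inj] at hprefix
  have hpos := (meetsOnlyAtEnd_branch R).2 c ((List.prefix_append _ _).trans hprefix) (by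
    rintro rfl
    simpa using hprefix.length_le)
  rw [← horiz_append (nonCrossing_branch N L).1, hc, ← canopy_node, hV,
    horiz_interiorPath_left hL'] at hpos
  exact hpos.false

theorem interiorPath_canopy_injective {T T' : BinaryTree Unit} (hnum : T.numNodes = T'.numNodes)
    (hU : interiorPath T = interiorPath T') (hV : canopy T = canopy T') : T = T' := by
  induction T generalizing T' with
  | nil => cases T' with
    | nil => rfl
    | node => simp at hnum
  | node _ L R ihL ihR => cases T' with
    | nil => simp at hnum
    | node _ L' R' =>
      have hL : L.numNodes = L'.numNodes :=
        (numNodes_left_le hU.symm hV.symm).antisymm (numNodes_left_le hU hV)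
      have hR : R.numNodes = R'.numNodes := by
        simp only [numNodes] at hnum
        omega
      have hlen (s : Step) {A B : BinaryTree Unit} (h : A.numNodes = B.numNodes) :
          (branchCanopy s A).length = (branchCanopy s B).length := by
        rw [← length_eq_of_endpoint_eq (nonCrossing_branch s A).1, length_branchPath, h,
          ← length_branchPath s B, length_eq_of_endpoint_eq (nonCrossing_branch s B).1]
      obtain ⟨hLU, hRU⟩ := List.append_inj hU (by rw [length_branchPath, length_branchPath, hL])
      rw [canopy_node, canopy_node] at hV
      obtain ⟨hLV, hRV⟩ := List.append_inj hV (hlen N hL)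
      rw [ihL hL (by rw [← dropLast_branchPath N L, hLU, dropLast_branchPath])
          (by rw [← dropLast_branchCanopy_north L, hLV, dropLast_branchCanopy_north]),
        ihR hR (by rw [← dropLast_branchPath E R, hRU, dropLast_branchPath])
          (by rw [← tail_branchCanopy_east R, hRV, tail_branchCanopy_east])]

theorem NonCrossing.exists_tree {u v : LatticePath} (h : NonCrossing u v) :
    ∃ T ≠ BinaryTree.nil, interiorPath T = u ∧ canopy T = v := by
  induction hn : u.length using Nat.strong_induction_on generalizing u v with
  | _ n ih =>
  subst hn
  have exists_right {q w : LatticePath} (hq : MeetsOnlyAtEnd q w) (hlen : q.length ≤ u.length) :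
      ∃ R, branchPath E R = q ∧ branchCanopy E R = w := by
    obtain ⟨rfl, rfl⟩ | ⟨q, w, rfl, rfl, hqw⟩ := hq.eq_nil_or_shift_east
    · exact ⟨.nil, rfl, rfl⟩
    · obtain ⟨R, hR, rfl, rfl⟩ := ih q.length (by simpa using hlen) hqw rfl
      exact ⟨R, branchPath_of_ne_nil E hR, branchCanopy_east_of_ne_nil hR⟩
  obtain h | ⟨p, q, v₁, v₂, rfl, rfl, hp, hq⟩ := h.meetsOnlyAtEnd_or_split
  · obtain ⟨R, rfl, rfl⟩ := exists_right h le_rfl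
    exact ⟨.node () .nil R, by simp, rfl, by simp [canopy_node, branchCanopy]⟩
  · obtain ⟨L, hL, rfl, rfl⟩ := ih p.length (by simp) hp rfl
    obtain ⟨R, rfl, rfl⟩ := exists_right hq (by simp; omega)
    refine ⟨.node () L R, by simp, ?_, ?_⟩
    · simp [interiorPath, branchPath_of_ne_nil N hL]
    · simp [canopy_node, branchCanopy_north_of_ne_nil hL]

/-! ### Covering relations -/

/-- `d` leads from the end of `q` to the next point at the same horizontal distance to `v`, starting
with a north step: it is the part of a path that a covering relation moves. -/
structure FirstReturn (v q d : LatticePath) : Prop where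
  head : d.head? = some N
  horiz_eq : horiz v (endpoint (q ++ d)) = horiz v (endpoint q)
  horiz_ne : ∀ d', d' <+: d → d' ≠ [] → d' ≠ d →
    horiz v (endpoint (q ++ d')) ≠ horiz v (endpoint q)

theorem FirstReturn.ne_nil {v q d : LatticePath} (h : FirstReturn v q d) : d ≠ [] := by
  rintro rfl
  simpa using h.head

theorem FirstReturn.unique {v q d₁ d₂ b₁ b₂ : LatticePath} (h₁ : FirstReturn v q d₁)
    (h₂ : FirstReturn v q d₂) (h : d₁ ++ b₁ = d₂ ++ b₂) : d₁ = d₂ := by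
  by_contra hne
  rcases List.prefix_or_prefix_of_prefix ⟨b₁, h⟩ (List.prefix_append d₂ b₂) with hd | hd
  · exact h₂.horiz_ne d₁ hd h₁.ne_nil hne h₁.horiz_eq
  · exact h₁.horiz_ne d₂ hd h₂.ne_nil (Ne.symm hne) h₂.horiz_eq

theorem FirstReturn.congr {v w q q' d : LatticePath} (h : FirstReturn v q d) (k : ℤ)
    (hk : ∀ d', d' <+: d → horiz w (endpoint (q' ++ d')) = horiz v (endpoint (q ++ d')) + k) :
    FirstReturn w q' d := by
  have h₀ := hk [] List.nil_prefix
  rw [List.append_nil, List.append_nil] at h₀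
  refine ⟨h.head, ?_, fun d' hd' hnil hne => ?_⟩
  · rw [hk d List.prefix_rfl, h₀, h.horiz_eq]
  · rw [hk d' hd', h₀]
    exact fun heq => h.horiz_ne d' hd' hnil hne (add_right_cancel heq)

theorem FirstReturn.prepend {v q d p w : LatticePath} (h : FirstReturn v q d)
    (he : endpoint p = endpoint w) : FirstReturn (w ++ v) (p ++ q) d :=
  h.congr 0 fun d' _ => by rw [List.append_assoc, horiz_append he, add_zero]

theorem MeetsOnlyAtEnd.firstReturn {u v : LatticePath} (h : MeetsOnlyAtEnd u v) :
    FirstReturn (N :: v) [] (N :: u) := by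
  refine ⟨rfl, ?_, fun d hd hnil hne => ?_⟩
  · rw [List.nil_append, horiz_cons_north, h.1.1, horiz_endpoint_self]
    simp [horiz, rowEnd]
  · obtain rfl | ⟨d', rfl, hd'⟩ := List.prefix_cons_iff.1 hd
    · exact absurd rfl hnil
    rw [List.nil_append, horiz_cons_north]
    have hpos := h.2 d' hd' fun h => hne (by rw [h])
    simpa [horiz, rowEnd] using hpos.ne'

/-- The path `u'` covers `u` in `Tam v` by switching the east step of `u` that follows the prefix
`a`. -/
def SwitchAt (v a u u' : LatticePath) : Prop :=
  ∃ d b, u = a ++ [E] ++ d ++ b ∧ FirstReturn v (a ++ [E]) d ∧ u' = a ++ d ++ [E] ++ b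

theorem cover_iff_exists_switchAt {v u u' : LatticePath} :
    Cover v u u' ↔ ∃ a, SwitchAt v a u u' :=
  ⟨fun ⟨a, d, b, hu, hd, heq, hne, hu'⟩ => ⟨a, d, b, hu, ⟨hd, heq, hne⟩, hu'⟩,
    fun ⟨a, d, b, hu, ⟨hd, heq, hne⟩, hu'⟩ => ⟨a, d, b, hu, hd, heq, hne, hu'⟩⟩

theorem SwitchAt.unique {v a u u₁ u₂ : LatticePath} (h₁ : SwitchAt v a u u₁)
    (h₂ : SwitchAt v a u u₂) : u₁ = u₂ := by
  obtain ⟨d₁, b₁, rfl, hd₁, rfl⟩ := h₁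
  obtain ⟨d₂, b₂, h, hd₂, rfl⟩ := h₂
  rw [List.append_assoc _ d₁, List.append_assoc _ d₂, List.append_cancel_left_eq] at h
  obtain rfl := hd₁.unique hd₂ h
  rw [List.append_cancel_left h]

theorem SwitchAt.exists_eq_append_east_north {v a u u' : LatticePath} (h : SwitchAt v a u u') :
    ∃ b, u = a ++ E :: N :: b := by
  obtain ⟨d, b, rfl, hd, -⟩ := h
  obtain ⟨d, rfl⟩ := List.head?_eq_some_iff.1 hd.head
  exact ⟨d ++ b, by simp⟩

theorem SwitchAt.append_north {v a u u' : LatticePath} (h : SwitchAt v a u u')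
    (he : endpoint u = endpoint v) (w c : LatticePath) :
    SwitchAt (v ++ N :: w) a (u ++ c) (u' ++ c) := by
  obtain ⟨d, b, rfl, hd, rfl⟩ := h
  refine ⟨d, b ++ c, by simp, hd.congr 0 fun d' hd' => ?_, by simp⟩
  rw [add_zero, horiz_append_north]
  rw [← snd_endpoint v, ← he]
  exact (List.prefix_append_of_prefix ((List.prefix_append_right_inj _).2 hd')).count_le N

theorem SwitchAt.prepend {v a u u' p w : LatticePath} (h : SwitchAt v a u u')
    (he : endpoint p = endpoint w) : SwitchAt (w ++ v) (p ++ a) (p ++ u) (p ++ u') := by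
  obtain ⟨d, b, rfl, hd, rfl⟩ := h
  exact ⟨d, b, by simp, by simpa using hd.prepend he, by simp⟩

theorem SwitchAt.cons_east_append {v a u u' : LatticePath} (h : SwitchAt v a u u')
    (c : LatticePath) : SwitchAt (E :: v) a (u ++ c) (u' ++ c) := by
  obtain ⟨d, b, rfl, hd, rfl⟩ := h
  exact ⟨d, b ++ c, by simp, hd.congr 1 fun d' _ => horiz_cons_east v _, by simp⟩

/-! ### Rotations preserving the canopy -/

/-- A right rotation that preserves the canopy, that is, whose middle subtree `B` is not empty. The
label is the prefix of the path of the tree that precedes the traversal of the right edge above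
`B`, which the rotation turns into a left edge. -/
inductive RotationAt : LatticePath → BinaryTree Unit → BinaryTree Unit → Prop
  | root (A : BinaryTree Unit) {B : BinaryTree Unit} (hB : B ≠ .nil) (C : BinaryTree Unit) :
      RotationAt (branchPath N A ++ interiorPath B)
        (.node () (.node () A B) C) (.node () A (.node () B C))
  | left {a : LatticePath} {L L' : BinaryTree Unit} (h : RotationAt a L L')
      (R : BinaryTree Unit) : RotationAt a (.node () L R) (.node () L' R)
  | right (L : BinaryTree Unit) {a : LatticePath} {R R' : BinaryTree Unit}
      (h : RotationAt a R R') : RotationAt (branchPath N L ++ a) (.node () L R) (.node () L R')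

theorem RotationAt.rightRotation {a : LatticePath} {S T : BinaryTree Unit}
    (h : RotationAt a S T) : RightRotation S T := by
  induction h with
  | root A _ C => exact .root A _ C
  | left _ R ih => exact ih.left R
  | right L _ ih => exact ih.right L

theorem RightRotation.left_ne_nil {S T : BinaryTree Unit} (h : RightRotation S T) : S ≠ .nil := by
  cases h <;> simp

theorem RightRotation.right_ne_nil {S T : BinaryTree Unit} (h : RightRotation S T) :
    T ≠ .nil := by
  cases h <;> simp

theorem RotationAt.canopy_eq {a : LatticePath} {S T : BinaryTree Unit} (h : RotationAt a S T) :
    canopy S = canopy T := by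
  induction h with
  | root A hB C =>
    simp [canopy_node, branchCanopy_north_of_ne_nil, branchCanopy_east_of_ne_nil, hB]
  | left h R ih =>
    simp only [canopy_node, branchCanopy_north_of_ne_nil h.rightRotation.left_ne_nil,
      branchCanopy_north_of_ne_nil h.rightRotation.right_ne_nil, ih]
  | right L h ih =>
    simp only [canopy_node, branchCanopy_east_of_ne_nil h.rightRotation.left_ne_nil,
      branchCanopy_east_of_ne_nil h.rightRotation.right_ne_nil, ih]

-- Rotating about an empty middle subtree replaces a north step of the canopy by an east step.
theorem RightRotation.exists_rotationAt_or_count_lt {S T : BinaryTree Unit}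
    (h : RightRotation S T) :
    (∃ a, RotationAt a S T) ∨ (canopy S).count E < (canopy T).count E := by
  induction h with
  | root A B C =>
    rcases eq_or_ne B .nil with rfl | hB
    · right
      simp [branchCanopy, canopy_node]
    · exact Or.inl ⟨_, .root A hB C⟩
  | left R h ih =>
    refine ih.imp (fun ⟨a, ha⟩ => ⟨a, ha.left R⟩) fun hlt => ?_
    simpa [canopy_node, branchCanopy_north_of_ne_nil h.left_ne_nil,
      branchCanopy_north_of_ne_nil h.right_ne_nil] using hlt
  | right L h ih =>
    refine ih.imp (fun ⟨a, ha⟩ => ⟨_, ha.right L⟩) fun hlt => ?_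
    simpa [canopy_node, branchCanopy_east_of_ne_nil h.left_ne_nil,
      branchCanopy_east_of_ne_nil h.right_ne_nil] using hlt

theorem switchAt_root (A : BinaryTree Unit) {B : BinaryTree Unit} (hB : B ≠ .nil)
    (C : BinaryTree Unit) :
    SwitchAt (canopy (.node () (.node () A B) C)) (branchPath N A ++ interiorPath B)
      (interiorPath (.node () (.node () A B) C)) (interiorPath (.node () A (.node () B C))) := by
  have hAB : branchPath N A ++ interiorPath B ++ [E] = branchPath N A ++ branchPath E B := by
    rw [branchPath_of_ne_nil E hB, List.append_assoc]
  have hreturn := (meetsOnlyAtEnd_branch C).firstReturn.prepend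
    (endpoint_interiorPath (.node () A B))
  refine ⟨N :: branchPath E C, [], ?_, ?_, ?_⟩
  · simp [hAB, interiorPath_node, branchPath]
  · rw [hAB, canopy_node]
    simpa [interiorPath_node, branchCanopy_north_of_ne_nil] using hreturn
  · simp [interiorPath_node, branchPath_of_ne_nil, hB]

theorem RotationAt.switchAt {a : LatticePath} {S T : BinaryTree Unit} (h : RotationAt a S T) :
    SwitchAt (canopy S) a (interiorPath S) (interiorPath T) := by
  induction h with
  | root A hB C => exact switchAt_root A hB C
  | @left _ L _ h R ih =>
    simpa [canopy_node, interiorPath_node, branchCanopy_north_of_ne_nil h.rightRotation.left_ne_nil,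
      branchPath_of_ne_nil N h.rightRotation.left_ne_nil,
      branchPath_of_ne_nil N h.rightRotation.right_ne_nil] using
      ih.append_north (endpoint_interiorPath L) (branchCanopy E R) (N :: branchPath E R)
  | right L h ih =>
    simpa [canopy_node, interiorPath_node, branchCanopy_east_of_ne_nil h.rightRotation.left_ne_nil,
      branchPath_of_ne_nil E h.rightRotation.left_ne_nil,
      branchPath_of_ne_nil E h.rightRotation.right_ne_nil] using
      (ih.cons_east_append [E]).prepend (nonCrossing_branch N L).1

theorem append_eq_append_east_north {x y a b : LatticePath} (hx : x.getLast? ≠ some E)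
    (h : x ++ y = a ++ E :: N :: b) :
    (∃ b', x = a ++ E :: N :: b') ∨ ∃ a', a = x ++ a' ∧ y = a' ++ E :: N :: b := by
  rcases List.append_eq_append_iff.1 h with ⟨c, ha, hy⟩ | ⟨c, rfl, hc⟩
  · exact Or.inr ⟨c, ha, hy⟩
  · rcases c with _ | ⟨_, _ | ⟨_, c⟩⟩ <;> simp_all

theorem interiorPath_eq_of_branchPath_eq {s : Step} {T : BinaryTree Unit} {a b : LatticePath}
    (h : branchPath s T = a ++ E :: N :: b) :
    (∃ b', interiorPath T = a ++ E :: N :: b') ∨ (s = N ∧ interiorPath T = a ++ [E]) := by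
  have hT : T ≠ .nil := by
    rintro rfl
    simp [branchPath] at h
  rw [branchPath_of_ne_nil s hT] at h
  rcases List.eq_nil_or_concat' b with rfl | ⟨b, t, rfl⟩
  · obtain ⟨hpath, hs⟩ := List.append_inj' (h.trans (List.append_cons a E [N])) rfl
    exact Or.inr ⟨List.singleton_inj.1 hs, hpath⟩
  · rw [← List.cons_append, ← List.cons_append, ← List.append_assoc] at h
    exact Or.inl ⟨b, List.append_inj_left' h rfl⟩

theorem exists_node_of_interiorPath_eq {T : BinaryTree Unit} {a : LatticePath}
    (h : interiorPath T = a ++ [E]) :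
    ∃ A B, T = .node () A B ∧ B ≠ .nil ∧ a = branchPath N A ++ interiorPath B := by
  rcases T with _ | ⟨_, A, B⟩
  · simp [interiorPath] at h
  have hB : B ≠ .nil := by
    rintro rfl
    have := congrArg List.getLast? h
    cases A <;> simp [interiorPath, branchPath] at this
  rw [interiorPath, branchPath_of_ne_nil E hB, ← List.append_assoc] at h
  exact ⟨A, B, rfl, hB, (List.append_inj_left' h rfl).symm⟩

theorem exists_rotationAt_of_east_north {T : BinaryTree Unit} {a b : LatticePath}
    (h : interiorPath T = a ++ E :: N :: b) : ∃ T', RotationAt a T T' := by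
  induction T generalizing a b with
  | nil => simp [interiorPath] at h
  | node _ L R ihL ihR =>
    have hlast : (branchPath N L).getLast? ≠ some E := by cases L <;> simp [branchPath]
    obtain ⟨b', hL⟩ | ⟨a', rfl, hR⟩ := append_eq_append_east_north hlast h
    · obtain ⟨c, hL⟩ | ⟨-, hL⟩ := interiorPath_eq_of_branchPath_eq hL
      · obtain ⟨L', hL'⟩ := ihL hL
        exact ⟨_, hL'.left R⟩
      · obtain ⟨A, B, rfl, hB, rfl⟩ := exists_node_of_interiorPath_eq hL
        exact ⟨_, .root A hB R⟩
    · obtain ⟨c, hR⟩ | ⟨hEN, -⟩ := interiorPath_eq_of_branchPath_eq hR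
      · obtain ⟨R', hR'⟩ := ihR hR
        exact ⟨_, hR'.right L⟩
      · cases hEN

theorem rightRotation_iff_cover {S T : BinaryTree Unit} (hnum : S.numNodes = T.numNodes)
    (hc : canopy S = canopy T) :
    RightRotation S T ↔ Cover (canopy S) (interiorPath S) (interiorPath T) := by
  rw [cover_iff_exists_switchAt]
  refine ⟨fun h => ?_, fun ⟨a, ha⟩ => ?_⟩
  · obtain ⟨a, ha⟩ := h.exists_rotationAt_or_count_lt.resolve_right (by simp [hc])
    exact ⟨a, ha.switchAt⟩
  · obtain ⟨b, hb⟩ := ha.exists_eq_append_east_north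
    obtain ⟨T', hT'⟩ := exists_rotationAt_of_east_north hb
    obtain rfl : T = T' := interiorPath_canopy_injective
      (hnum.symm.trans hT'.rightRotation.numNodes_eq) (ha.unique hT'.switchAt)
      (hc.symm.trans hT'.canopy_eq)
    exact hT'.rightRotation

/-! ### The trees with a given canopy form an interval -/

theorem TamariTree.ne_nil {n : ℕ} (hn : 1 ≤ n) (T : TamariTree n) : T.1 ≠ .nil := by
  obtain ⟨T, rfl⟩ := T
  rintro rfl
  simp at hn

instance (n : ℕ) : Finite (TamariTree n) :=
  Set.Finite.to_subtype (s := {T : BinaryTree Unit | T.numNodes = n}) <|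
    (treesOfNumNodesEq n).finite_toSet.subset fun _ hT => mem_treesOfNumNodesEq.2 hT

theorem TamariTree.canopy_eq_or_count_lt_of_le {n : ℕ} {S T : TamariTree n} (h : S ≤ T) :
    canopy S.1 = canopy T.1 ∨ (canopy S.1).count E < (canopy T.1).count E := by
  replace h : ReflTransGen (fun S T : TamariTree n => RightRotation S.1 T.1) S T := h
  induction h with
  | refl => exact Or.inl rfl
  | tail _ hr ih =>
    have hstep := hr.exists_rotationAt_or_count_lt.imp_left fun ⟨_, ha⟩ => ha.canopy_eq
    grind

theorem ordConnected_canopyClass (n : ℕ) (v : LatticePath) : (canopyClass n v).OrdConnected := by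
  refine ⟨fun S hS T hT X ⟨hSX, hXT⟩ => ?_⟩
  have hSX := TamariTree.canopy_eq_or_count_lt_of_le hSX
  have hXT := TamariTree.canopy_eq_or_count_lt_of_le hXT
  simp only [canopyClass, Set.mem_ofPred_eq] at *
  grind

theorem canopyClass_le_iff {n : ℕ} {v : LatticePath} (S T : canopyClass n v) :
    S ≤ T ↔ ReflTransGen (fun X Y : canopyClass n v => RightRotation X.1.1 Y.1.1) S T :=
  (reflTransGen_subtype_iff (p := (· ∈ canopyClass n v)) (fun _ _ _ hxy hyz hx hz =>
    (ordConnected_canopyClass n v).out hx hz ⟨hxy, hyz⟩) S T).symm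

theorem not_rotationAt_of_maximal {n : ℕ} {v a : LatticePath} {T : TamariTree n}
    (hT : Maximal (· ∈ canopyClass n v) T) (X : BinaryTree Unit) : ¬ RotationAt a T.1 X := by
  intro ha
  let Y : TamariTree n := ⟨X, ha.rightRotation.numNodes_eq.symm.trans T.2⟩
  have hTY : T ≤ Y := ReflTransGen.single ha.rightRotation
  have hYT : Y ≤ T := hT.2 (ha.canopy_eq.symm.trans hT.1) hTY
  have hlt : rightWeight T.1 < rightWeight Y.1 := ha.rightRotation.rightWeight_lt
  exact hlt.ne (congrArg (fun Z : TamariTree n => rightWeight Z.1) (hTY.antisymm hYT))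

theorem not_rotationAt_of_minimal {n : ℕ} {v a : LatticePath} {T : TamariTree n}
    (hT : Minimal (· ∈ canopyClass n v) T) (X : BinaryTree Unit) : ¬ RotationAt a X T.1 := by
  intro ha
  let Y : TamariTree n := ⟨X, ha.rightRotation.numNodes_eq.trans T.2⟩
  have hYT : Y ≤ T := ReflTransGen.single ha.rightRotation
  have hTY : T ≤ Y := hT.2 (ha.canopy_eq.trans hT.1) hYT
  have hlt : rightWeight Y.1 < rightWeight T.1 := ha.rightRotation.rightWeight_lt
  exact hlt.ne (congrArg (fun Z : TamariTree n => rightWeight Z.1) (hYT.antisymm hTY))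

theorem isChain_of_forall_ne_append_east_north {w : LatticePath}
    (h : ∀ a b, w ≠ a ++ E :: N :: b) : w.IsChain fun s t => s = N ∨ t = E := by
  refine List.isChain_iff_forall_rel_of_append_cons_cons.2 fun {s t a b} hw => ?_
  have := h a b
  cases s <;> cases t <;> simp_all

theorem eq_of_isChain_of_endpoint_eq {u w : LatticePath} (he : endpoint u = endpoint w)
    (hu : u.IsChain fun s t => s = N ∨ t = E) (hw : w.IsChain fun s t => s = N ∨ t = E) :
    u = w := by
  have : Trans (α := Step) (fun s t => s = N ∨ t = E) (fun s t => s = N ∨ t = E)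
      (fun s t => s = N ∨ t = E) := ⟨fun h h' => by grind⟩
  refine (List.perm_iff_count.2 (count_eq_of_endpoint_eq he)).eq_of_pairwise ?_
    (List.isChain_iff_pairwise.1 hu) (List.isChain_iff_pairwise.1 hw)
  grind

theorem branch_east_eq_replicate_of_not_rotationAt {L R : BinaryTree Unit}
    (h : ∀ a S, ¬ RotationAt a S (.node () L R)) :
    branchPath E R = List.replicate R.numNodes E ∧
      branchCanopy E R = List.replicate R.numNodes E := by
  induction R generalizing L with
  | nil => simp
  | node _ B C _ ihC =>
    obtain rfl : B = .nil := by
      by_contra hB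
      exact h _ _ (.root L hB C)
    obtain ⟨hpath, hcanopy⟩ := ihC fun a S hS => h _ _ (hS.right L)
    simp [branchPath, branchCanopy_east_of_ne_nil, canopy_node, hpath, hcanopy,
      ← List.replicate_succ, ← List.replicate_succ']

theorem interiorPath_eq_canopy_of_not_rotationAt {T : BinaryTree Unit}
    (h : ∀ a S, ¬ RotationAt a S T) : interiorPath T = canopy T := by
  induction T with
  | nil => rfl
  | node _ L R ihL _ =>
    obtain ⟨hpath, hcanopy⟩ := branch_east_eq_replicate_of_not_rotationAt h
    have hL : branchPath N L = branchCanopy N L := by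
      rcases eq_or_ne L .nil with rfl | hL
      · simp
      · rw [branchPath_of_ne_nil N hL, branchCanopy_north_of_ne_nil hL,
          ihL fun a S hS => h a _ (hS.left R)]
    rw [interiorPath_node, canopy_node, hL, hpath, hcanopy]

theorem minimal_unique_canopyClass {n : ℕ} {v : LatticePath} {S T : TamariTree n}
    (hS : Minimal (· ∈ canopyClass n v) S) (hT : Minimal (· ∈ canopyClass n v) T) :
    S = T := by
  have hpath {X : TamariTree n} (hX : Minimal (· ∈ canopyClass n v) X) : interiorPath X.1 = v :=
    (interiorPath_eq_canopy_of_not_rotationAt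
      fun _ => not_rotationAt_of_minimal hX).trans hX.1
  exact Subtype.ext <| interiorPath_canopy_injective (S.2.trans T.2.symm)
    ((hpath hS).trans (hpath hT).symm) (Eq.trans hS.1 hT.1.symm)

theorem maximal_unique_canopyClass {n : ℕ} {v : LatticePath} {S T : TamariTree n}
    (hS : Maximal (· ∈ canopyClass n v) S) (hT : Maximal (· ∈ canopyClass n v) T) :
    S = T := by
  have hchain {X : TamariTree n} (hX : Maximal (· ∈ canopyClass n v) X) :
      (interiorPath X.1).IsChain fun s t => s = N ∨ t = E :=
    isChain_of_forall_ne_append_east_north fun a b h => by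
      obtain ⟨Y, hY⟩ := exists_rotationAt_of_east_north h
      exact not_rotationAt_of_maximal hX Y hY
  have hc : canopy S.1 = canopy T.1 := Eq.trans hS.1 hT.1.symm
  refine Subtype.ext <| interiorPath_canopy_injective (S.2.trans T.2.symm) ?_ hc
  refine eq_of_isChain_of_endpoint_eq ?_ (hchain hS) (hchain hT)
  rw [endpoint_interiorPath, endpoint_interiorPath, hc]

theorem exists_eq_Icc_of_minimal_unique {α : Type*} [PartialOrder α] {s : Set α}
    (hfin : s.Finite) (hne : s.Nonempty) (hs : s.OrdConnected)
    (hmin : ∀ ⦃a b⦄, Minimal (· ∈ s) a → Minimal (· ∈ s) b → a = b)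
    (hmax : ∀ ⦃a b⦄, Maximal (· ∈ s) a → Maximal (· ∈ s) b → a = b) :
    ∃ a b, a ≤ b ∧ s = Set.Icc a b := by
  obtain ⟨a, ha⟩ := hfin.exists_minimal hne
  obtain ⟨b, hb⟩ := hfin.exists_maximal hne
  have hle : ∀ x ∈ s, a ≤ x ∧ x ≤ b := fun x hx => by
    obtain ⟨a', ha'x, ha'⟩ := hfin.exists_le_minimal hx
    obtain ⟨b', hxb', hb'⟩ := hfin.exists_le_maximal hx
    exact ⟨hmin ha ha' ▸ ha'x, hmax hb hb' ▸ hxb'⟩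
  exact ⟨a, b, (hle a ha.1).2, Set.Subset.antisymm hle (hs.out ha.1 hb.1)⟩

theorem exists_canopyClass_eq_Icc {n : ℕ} {v : LatticePath} (hne : (canopyClass n v).Nonempty) :
    ∃ S T : TamariTree n, S ≤ T ∧ canopyClass n v = Set.Icc S T :=
  exists_eq_Icc_of_minimal_unique (Set.toFinite _) hne (ordConnected_canopyClass n v)
    (fun _ _ => minimal_unique_canopyClass) fun _ _ => maximal_unique_canopyClass

/-! ### The trees with canopy `v` are ordered as `Tam v` -/

/-- The interior path of a tree with canopy `v`, as an element of `Tam v`. -/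
def canopyClassToTam {n : ℕ} {v : LatticePath} (T : canopyClass n v) : Tam v :=
  ⟨interiorPath T.1.1, by
    obtain ⟨T, rfl⟩ := T
    exact nonCrossing_interiorPath_canopy T.1⟩

theorem bijective_canopyClassToTam {n : ℕ} {v : LatticePath} (hv : v.length + 1 = n) :
    Function.Bijective (canopyClassToTam (n := n) (v := v)) := by
  refine ⟨fun S T h => ?_, fun u => ?_⟩
  · exact Subtype.ext <| Subtype.ext <| interiorPath_canopy_injective (S.1.2.trans T.1.2.symm)
      (congrArg Subtype.val h) (Eq.trans S.2 T.2.symm)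
  · obtain ⟨T, hT, hpath, rfl⟩ := NonCrossing.exists_tree u.2
    exact ⟨⟨⟨T, (length_canopy_add_one hT).symm.trans hv⟩, rfl⟩, Subtype.ext hpath⟩

/-- The order isomorphism from `I(v)` onto `Tam v`, sending a tree to its interior path. -/
noncomputable def canopyClassOrderIsoTam {n : ℕ} {v : LatticePath} (hv : v.length + 1 = n) :
    canopyClass n v ≃o Tam v where
  toEquiv := .ofBijective canopyClassToTam (bijective_canopyClassToTam hv)
  map_rel_iff' {S T} := by
    refine Iff.trans ?_ (canopyClass_le_iff S T).symm
    refine reflTransGen_apply_iff (s := fun x y : Tam v => Cover v x.1 y.1) _ (fun X Y => ?_) S T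
    obtain ⟨⟨X, hX⟩, rfl⟩ := X
    exact (rightRotation_iff_cover (hX.trans Y.1.2.symm) Y.2.symm).symm

/-! ### Complete binary trees -/

/-- The completion of a binary tree, with its external vertices turned into nodes: the internal
edges of `complete T` are all the edges of the complete binary tree represented by `T`. -/
def complete : BinaryTree Unit → BinaryTree Unit
  | .nil => .node () .nil .nil
  | .node _ L R => .node () (complete L) (complete R)

theorem complete_ne_nil (T : BinaryTree Unit) : complete T ≠ .nil := by
  cases T <;> simp [complete]

theorem numNodes_complete (T : BinaryTree Unit) :
    (complete T).numNodes = 2 * T.numNodes + 1 := by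
  induction T with
  | nil => rfl
  | node _ L R ihL ihR =>
    simp only [complete, numNodes, ihL, ihR]
    ring

theorem complete_injective : Function.Injective complete := by
  intro S T h
  induction S generalizing T with
  | nil => cases T with
    | nil => rfl
    | node _ A B => simp [complete, (complete_ne_nil A).symm] at h
  | node _ L R ihL ihR => cases T with
    | nil => simp [complete, complete_ne_nil] at h
    | node _ A B =>
      simp only [complete, node.injEq, true_and] at h
      rw [ihL h.1, ihR h.2]

theorem interiorPath_complete (T : BinaryTree Unit) :
    interiorPath (complete T) = postorderPath T := by
  induction T with
  | nil => rfl
  | node _ L R ihL ihR =>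
    simp [complete, postorderPath, interiorPath_node, branchPath_of_ne_nil, complete_ne_nil, ihL,
      ihR]

theorem staircase_add (m n : ℕ) : staircase (m + n) = staircase m ++ staircase n := by
  rw [staircase, List.replicate_add, List.flatten_append, staircase, staircase]

theorem staircase_succ (n : ℕ) : staircase (n + 1) = N :: E :: staircase n := rfl

theorem length_staircase (n : ℕ) : (staircase n).length = 2 * n := by
  simp [staircase, mul_comm]

theorem canopy_complete (T : BinaryTree Unit) : canopy (complete T) = staircase T.numNodes := by
  induction T with
  | nil => rfl
  | node _ L R ihL ihR =>
    rw [numNodes, add_assoc, staircase_add, staircase_succ]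
    simp [complete, canopy_node, branchCanopy_north_of_ne_nil, branchCanopy_east_of_ne_nil,
      complete_ne_nil, ihL, ihR]

theorem isChain_ne_staircase (n : ℕ) : (E :: (staircase n ++ [N])).IsChain (· ≠ ·) := by
  induction n with
  | zero => simp [staircase]
  | succ n ih => simpa [staircase_succ] using ih

theorem exists_eq_complete {F : BinaryTree Unit} (hF : F ≠ .nil)
    (h : (E :: (canopy F ++ [N])).IsChain (· ≠ ·)) : ∃ T, F = complete T := by
  induction F with
  | nil => contradiction
  | node _ L R ihL ihR =>
    rw [canopy_node] at h
    rcases eq_or_ne L .nil with rfl | hL <;> rcases eq_or_ne R .nil with rfl | hR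
    · exact ⟨.nil, rfl⟩
    · simp [branchCanopy_east_of_ne_nil hR] at h
    · rw [branchCanopy_north_of_ne_nil hL] at h
      have hNN := h.infix (l₁ := [N, N]) ⟨E :: canopy L, [], by simp⟩
      simp at hNN
    · rw [branchCanopy_north_of_ne_nil hL, branchCanopy_east_of_ne_nil hR] at h
      obtain ⟨A, rfl⟩ := ihL hL (h.infix ⟨[], E :: (canopy R ++ [N]), by simp⟩)
      obtain ⟨B, rfl⟩ := ihR hR (h.infix ⟨E :: (canopy (complete A) ++ [N]), [], by simp⟩)
      exact ⟨.node () A B, rfl⟩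

theorem RightRotation.complete {S T : BinaryTree Unit} (h : RightRotation S T) :
    RightRotation (complete S) (complete T) := by
  induction h with
  | root A B C => exact .root _ _ _
  | left R _ ih => exact ih.left _
  | right L _ ih => exact ih.right _

theorem RotationAt.exists_eq_complete {a : LatticePath} {F F' S : BinaryTree Unit}
    (h : RotationAt a F F') (hF : F = complete S) :
    ∃ T, F' = complete T ∧ RightRotation S T := by
  induction h generalizing S with
  | root A hB C =>
    rcases S with _ | ⟨_, _ | ⟨_, L, M⟩, R⟩
    · simp [complete] at hF
    · simp [complete, hB] at hF
    · simp only [complete, node.injEq, true_and] at hF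
      obtain ⟨⟨rfl, rfl⟩, rfl⟩ := hF
      exact ⟨.node () L (.node () M R), rfl, .root L M R⟩
  | left h C ih =>
    have hne := h.rightRotation.left_ne_nil
    rcases S with _ | ⟨_, L, R⟩
    · simp [complete, hne] at hF
    · simp only [complete, node.injEq, true_and] at hF
      obtain ⟨hL, rfl⟩ := hF
      obtain ⟨T, rfl, hT⟩ := ih hL
      exact ⟨.node () T R, rfl, hT.left R⟩
  | right A h ih =>
    have hne := h.rightRotation.left_ne_nil
    rcases S with _ | ⟨_, L, R⟩
    · simp [complete, hne] at hF
    · simp only [complete, node.injEq, true_and] at hF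
      obtain ⟨rfl, hR⟩ := hF
      obtain ⟨T, rfl, hT⟩ := ih hR
      exact ⟨.node () L T, rfl, hT.right L⟩

theorem rightRotation_complete_iff {S T : BinaryTree Unit} (hnum : S.numNodes = T.numNodes) :
    RightRotation (complete S) (complete T) ↔ RightRotation S T := by
  refine ⟨fun h => ?_, .complete⟩
  obtain ⟨a, ha⟩ := h.exists_rotationAt_or_count_lt.resolve_right
    (by simp [canopy_complete, hnum])
  obtain ⟨T', hT, hrot⟩ := ha.exists_eq_complete rfl
  rwa [complete_injective hT]

/-- The completion of a complete binary tree with `n` interior vertices, as a tree with canopy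
`(NE)^n`. -/
def completeToCanopyClass {n : ℕ} (T : TamariTree n) : canopyClass (2 * n + 1) (staircase n) :=
  ⟨⟨complete T.1, by rw [numNodes_complete, T.2]⟩, (canopy_complete T.1).trans (by rw [T.2])⟩

theorem bijective_completeToCanopyClass (n : ℕ) :
    Function.Bijective (completeToCanopyClass (n := n)) := by
  refine ⟨fun S T h => Subtype.ext (complete_injective ?_), fun ⟨⟨F, hnum⟩, hF⟩ => ?_⟩
  · exact congrArg (fun X => X.1.1) h
  · obtain ⟨T, rfl⟩ := exists_eq_complete (F := F) (by rintro rfl; simp at hnum)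
      (by rw [show canopy F = staircase n from hF]; exact isChain_ne_staircase n)
    rw [numNodes_complete] at hnum
    exact ⟨⟨T, by omega⟩, rfl⟩

/-- Completion as an order isomorphism from the complete binary trees with `n` interior vertices
onto the trees with canopy `(NE)^n`. -/
noncomputable def completeOrderIso (n : ℕ) :
    TamariTree n ≃o canopyClass (2 * n + 1) (staircase n) where
  toEquiv := .ofBijective completeToCanopyClass (bijective_completeToCanopyClass n)
  map_rel_iff' {S T} := by
    refine Iff.trans (canopyClass_le_iff _ _) ?_
    exact reflTransGen_apply_iff (r := fun X Y : TamariTree n => RightRotation X.1 Y.1)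
      (.ofBijective _ (bijective_completeToCanopyClass n))
      (fun X Y => rightRotation_complete_iff (X.2.trans Y.2.symm)) S T

/-- The post-order traversal on edges, as an order isomorphism: it sends `T` to the interior path
of `complete T`. -/
noncomputable def postorderOrderIso (n : ℕ) : TamariTree n ≃o Tam (staircase n) :=
  (completeOrderIso n).trans (canopyClassOrderIsoTam (by rw [length_staircase]))

theorem coe_postorderOrderIso {n : ℕ} (T : TamariTree n) :
    (postorderOrderIso n T).1 = postorderPath T.1 :=
  interiorPath_complete T.1

end NuTamari

theorem theorem3 (n : ℕ) (hn : 1 ≤ n) :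
    ∃ φ : TamariTree n ≃o Tam (staircase n),
      (∀ T : TamariTree n, (φ T).1 = postorderPath T.1) ∧
      (⋃ v ∈ {v : LatticePath | v.length + 1 = n}, φ '' canopyClass n v) = Set.univ ∧
      {v : LatticePath | v.length + 1 = n}.PairwiseDisjoint (fun v => φ '' canopyClass n v) ∧
      ∀ v : LatticePath, v.length + 1 = n →
        (∃ S T : TamariTree n, S ≤ T ∧
          canopyClass n v = Set.Icc S T ∧
          φ '' canopyClass n v = Set.Icc (φ S) (φ T)) ∧
        Nonempty (canopyClass n v ≃o Tam v) := by
  refine ⟨postorderOrderIso n, coe_postorderOrderIso, ?_, ?_, fun v hv => ?_⟩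
  · refine Set.eq_univ_of_forall fun u => ?_
    obtain ⟨T, rfl⟩ := (postorderOrderIso n).surjective u
    have hlen : (canopy T.1).length + 1 = n := (length_canopy_add_one (T.ne_nil hn)).trans T.2
    exact Set.mem_biUnion hlen (Set.mem_image_of_mem _ rfl)
  · intro v _ w _ hvw
    refine (Set.disjoint_image_iff (postorderOrderIso n).injective).2 ?_
    exact Set.disjoint_left.2 fun T hv hw => hvw (Eq.trans (Eq.symm hv) hw)
  · have e : canopyClass n v ≃o Tam v := canopyClassOrderIsoTam hv
    have hne : (canopyClass n v).Nonempty :=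
      Set.nonempty_of_mem (e.symm ⟨v, NonCrossing.refl v⟩).2
    obtain ⟨S, T, hle, hIcc⟩ := exists_canopyClass_eq_Icc hne
    exact ⟨⟨S, T, hle, hIcc, by rw [hIcc, OrderIso.image_Icc]⟩, ⟨e⟩⟩
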